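/- **Conventions.** $\mathbb N=\{1,2,\dots\}$, $\mathbb N_0=\mathbb N\cup\{0\}$, and $[a,b]=\{k\in\mathbb N_0: a\le k\le b\}$, which is empty if $a>b$. Let $G=(V,E)$ be a finite, simple, connected graph. A path on $G$ is a map $\gamma:\mathbb N_0\to V$ such that for every $n$ either $\{\gamma(n),\gamma(n+1)\}\in E$ or $\gamma(n+1)=\gamma(n)$. Write $\mathrm R(A)=\{\gamma(k):k\in A\}$ for $A\subseteq\mathbb N_0$. **Aldous–Broder tree.** For $n\in\mathbb N_0$ and $x\in\mathrm R([0,n])$ let $L_x(n)=\max\{k\in[0,n]:\gamma(k)=x\}$. $\mathrm{AB}^\gamma(n)$ is the graph with vertex set $\mathrm R([0,n])$, edges $\{x,\gamma(L_x(n)+1)\}$ for $x\in\mathrm R([0,n])\setminus\{\gamma(n)\}$, and root $\gamma(n)$. **Ghost indices and skeleton.** Let $s\in\mathbb N$, $s\ge 2$. Put $\mathcal G(0)=\emptyset$. For $n\ge1$, $\mathcal G(n)$ consists of $\mathcal G(n-1)$ and of all $m\in[0,n-1]\setminus\mathcal G(n-1)$ such that $\gamma(n)\in\mathrm R([n-s+1,m]\setminus\mathcal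 G(n-1))$ and, with $m_1=\max\{h\in[n-s+1,m]\setminus\mathcal G(n-1):\gamma(h)=\gamma(n)\}$, $$\gamma(k)\notin\mathrm R([0,k-1]\setminus\mathcal G(n-1))\quad\text{for all }k\in[m_1,n-1]\setminus\mathcal G(n-1).$$ $\mathrm{Skel}^{\gamma,s}(n)$ is the subgraph of $\mathrm{AB}^\gamma(n)$ induced on the vertex set $\mathrm R([0,n]\setminus\mathcal G(n))$, with root $\gamma(n)$. **Gromov–Hausdorff distance.** For pointed compact metric spaces $(T,d,\varrho)$ and $(T',d',\varrho')$ let $d_{\mathrm{GH}}=\frac12\inf_{\mathfrak R}\sup\{|d(x,y)-d'(x',y')|:(x,x'),(y,y')\in\mathfrak R\}$, where the infimum is over all $\mathfrak R\subseteq T\times T'$ that contain $(\varrho,\varrho')$ and project onto both $T$ and $T'$. A rooted tree is regarded as a pointed metric space with its own graph distance and its root. **Proposition.** Let $r,s,s'\in\mathbb N$ with $r\ge3s+1\ge18s'+1$, let $N\in\mathbb N_0$ and $K=\lfloor N/r\rfloor$. For $i\in\mathbb N_0$ put $I_i=[(i-1)r,\,ir-1]$ and $B_i=[(i-1)r+2s,\,ir-s-1]$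 (so $I_0=B_0=\emptyset$). Let $\gamma$ be a path on $G$ such that: * (No loops of intermediate length.) If $m_1,m_2\in[0,N]$ and $\gamma(m_1)=\gamma(m_2)$, then $|m_2-m_1|\notin[s',r]$. * (Local cut points.) For every $m\in[0,N-s]$ the interval $[m,m+s]$ contains a $2s'$-local cut point, that is, an $\ell\ge2s'$ with $\mathrm R([\ell-2s',\ell])\cap\mathrm R([\ell+1,\ell+2s'])=\emptyset$. * (P.1) If $i,j\in[0,K]$, $i\ne j$, and $\mathrm R(B_i)\cap\mathrm R(B_j)\neq\emptyset$, then $\mathrm R(B_{k_1})\cap\mathrm R(B_{k_2})=\emptyset$ for all $k_1,k_2\in[0,K]$ with $k_1\in\{i,j\}$ and $k_2\notin\{i,j\}$. * (P.2) For all $i\in[2,K]$ and $j\in[0,i-1]$: $\mathrm R(I_j\setminus B_j)\cap\mathrm R([\min B_i,\max B_i+s])=\emptyset$. * (P.3) For all $i\in[2,K]$: $\mathrm R([0,\max B_{i-1}])\cap\mathrm R(I_i\setminus B_i)=\emptyset$. * (P.4) $\mathrm R([0,rK-1])\cap\mathrm R([rK+2s,N])=\emptyset$ and $\mathrm R([0,rK-s-1])\cap\mathrm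 R([rK,rK+2s-1])=\emptyset$. Then for every $n\in[0,N]$ the graphs $\mathrm{Skel}^{\gamma,s}(n)$ and $\mathrm{AB}^\gamma(n)$ are trees, and $$d_{\mathrm{GH}}\big(\mathrm{Skel}^{\gamma,s}(n),\mathrm{AB}^\gamma(n)\big)\le r.$$ -/

import Mathlib

open scoped ENNReal

/-! ### Pointed Gromov–Hausdorff distance -/

/-- `R` is a correspondence between the pointed spaces `(X, x₀)` and `(Y, y₀)`. -/
def IsCorrespondence {X Y : Type*} (x₀ : X) (y₀ : Y) (R : Set (X × Y)) : Prop :=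
  (x₀, y₀) ∈ R ∧ (∀ x, ∃ y, (x, y) ∈ R) ∧ (∀ y, ∃ x, (x, y) ∈ R)

/-- The distortion of `R`, as an extended non-negative real number. -/
noncomputable def distortion {X Y : Type*} (mX : MetricSpace X) (mY : MetricSpace Y)
    (R : Set (X × Y)) : ℝ≥0∞ :=
  ⨆ p ∈ R, ⨆ q ∈ R, ENNReal.ofReal |dist p.1 q.1 - dist p.2 q.2|

/-- The pointed Gromov–Hausdorff distance: half of the infimum of the distortions of all
correspondences that contain the pair of base points. -/
noncomputable def pointedGHDist {X Y : Type*} (mX : MetricSpace X) (x₀ : X)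
    (mY : MetricSpace Y) (y₀ : Y) : ℝ≥0∞ :=
  (⨅ (R : Set (X × Y)) (_ : IsCorrespondence x₀ y₀ R), distortion mX mY R) / 2

/-- The graph distance of a connected graph, as a metric on its vertices. -/
@[reducible] noncomputable def graphMetric {α : Type*} (H : SimpleGraph α) (hH : H.Connected) :
    MetricSpace α where
  dist u v := (H.dist u v : ℝ)
  dist_self u := by simp
  dist_comm u v := by simp [SimpleGraph.dist_comm]
  dist_triangle u v w := by exact_mod_cast hH.dist_triangle
  eq_of_dist_eq_zero {u v} h := by
    have h' : H.dist u v = 0 := by exact_mod_cast h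
    exact hH.dist_eq_zero_iff.1 h'

/-! ### Paths and the Aldous–Broder map -/

/-- `γ` is a (lazy) path on `G`. -/
def IsLazyPath {V : Type*} (G : SimpleGraph V) (γ : ℕ → V) : Prop :=
  ∀ n, G.Adj (γ n) (γ (n + 1)) ∨ γ (n + 1) = γ n

/-- `k` is the time `L_x(n)` of the last visit of `γ` to `x` during `[0, n]`. -/
def IsLastVisit {V : Type*} (γ : ℕ → V) (n : ℕ) (x : V) (k : ℕ) : Prop :=
  IsGreatest {j | j ≤ n ∧ γ j = x} k

/-- `y` is the vertex `γ(L_x(n) + 1)` visited right after the last visit to `x` during `[0, n]`,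
where `x ≠ γ(n)`. -/
def IsABParent {V : Type*} (γ : ℕ → V) (n : ℕ) (x y : V) : Prop :=
  x ≠ γ n ∧ ∃ k, IsLastVisit γ n x k ∧ y = γ (k + 1)

theorem IsABParent.lt {V : Type*} {γ : ℕ → V} {n : ℕ} {x y : V} (h : IsABParent γ n x y) :
    ∃ k, k + 1 ≤ n ∧ x = γ k ∧ y = γ (k + 1) ∧ x ≠ y := by
  obtain ⟨hx, k, ⟨⟨hk, hkx⟩, hmax⟩, rfl⟩ := h
  have hlt : k + 1 ≤ n := by
    rcases Nat.lt_or_eq_of_le hk with h | h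
    · exact h
    · exact absurd (h ▸ hkx.symm) hx
  refine ⟨k, hlt, hkx.symm, rfl, fun he => ?_⟩
  have : k + 1 ≤ k := hmax ⟨hlt, he.symm⟩
  omega

/-- The Aldous–Broder tree `AB^γ(n)`: its vertices are those visited by `γ` during `[0, n]`, and its
edges are the pairs `{x, γ(L_x(n) + 1)}` for the visited vertices `x ≠ γ(n)`. Its root is `γ(n)`. -/
def abTree {V : Type*} {G : SimpleGraph V} {γ : ℕ → V} (hγ : IsLazyPath G γ) (n : ℕ) :
    G.Subgraph where
  verts := γ '' Set.Iic n
  Adj x y := IsABParent γ n x y ∨ IsABParent γ n y x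
  adj_sub {x y} h := by
    have key : ∀ {x y}, IsABParent γ n x y → G.Adj x y := by
      intro x y h
      obtain ⟨k, _, rfl, rfl, hne⟩ := h.lt
      exact (hγ k).resolve_right (fun h => hne h.symm)
    exact h.elim key (fun h => (key h).symm)
  edge_vert {x y} h := by
    rcases h with h | h
    · obtain ⟨k, hk, rfl, _, _⟩ := h.lt
      exact ⟨k, by simp only [Set.mem_Iic]; omega, rfl⟩
    · obtain ⟨k, hk, _, rfl, _⟩ := h.lt
      exact ⟨k + 1, hk, rfl⟩
  symm := ⟨fun _ _ h => h.symm⟩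

theorem root_mem_abTree {V : Type*} {G : SimpleGraph V} {γ : ℕ → V} (hγ : IsLazyPath G γ)
    (n : ℕ) : γ n ∈ (abTree hγ n).verts :=
  ⟨n, le_refl n, rfl⟩

/-! ### Ghost indices and the skeleton chain -/

/-- The condition on `m` to become a ghost index at time `n`, where `S` is the set of ghost indices
at time `n - 1`: the vertex `γ(n)` was visited at a non-ghost time in `[n - s + 1, m]`, and, for the
largest such time `m₁`, each non-ghost time `k ∈ [m₁, n - 1]` is a first visit among the non-ghost
times. -/
def GhostCondition {V : Type*} (γ : ℕ → V) (s n : ℕ) (S : Set ℕ) (m : ℕ) : Prop :=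
  γ n ∈ γ '' ({h | n + 1 ≤ h + s ∧ h ≤ m} \ S) ∧
    ∀ m₁, IsGreatest {h | h ∈ {h | n + 1 ≤ h + s ∧ h ≤ m} \ S ∧ γ h = γ n} m₁ →
      ∀ k ∈ {k | m₁ ≤ k ∧ k < n} \ S, γ k ∉ γ '' ({j | j < k} \ S)

/-- The set of ghost indices at time `n`. -/
def ghostSet {V : Type*} (γ : ℕ → V) (s : ℕ) : ℕ → Set ℕ
  | 0 => ∅
  | n + 1 => ghostSet γ s n ∪
      {m | m ≤ n ∧ m ∉ ghostSet γ s n ∧ GhostCondition γ s (n + 1) (ghostSet γ s n) m}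

theorem ghostSet_lt {V : Type*} (γ : ℕ → V) (s : ℕ) : ∀ n, ∀ m ∈ ghostSet γ s n, m < n
  | 0, _, hm => absurd hm (Set.notMem_empty _)
  | n + 1, m, hm => by
    rcases hm with hm | hm
    · have := ghostSet_lt γ s n m hm
      omega
    · have := hm.1
      omega

/-- The skeleton `Skel^{γ,s}(n)`: the subgraph of `AB^γ(n)` induced by the vertices visited at
non-ghost times in `[0, n]`. Its root is `γ(n)`. -/
def skel {V : Type*} {G : SimpleGraph V} {γ : ℕ → V} (hγ : IsLazyPath G γ) (s n : ℕ) :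
    G.Subgraph :=
  (abTree hγ n).induce (γ '' (Set.Iic n \ ghostSet γ s n))

theorem root_mem_skel {V : Type*} {G : SimpleGraph V} {γ : ℕ → V} (hγ : IsLazyPath G γ)
    (s n : ℕ) : γ n ∈ (skel hγ s n).verts :=
  ⟨n, ⟨le_refl n, fun h => lt_irrefl n (ghostSet_lt γ s n n h)⟩, rfl⟩

/-! ### Assumptions on the path -/

/-- No loops in `[0, N]` of length in `[s', r]`. -/
def NoIntermediateLoops {V : Type*} (γ : ℕ → V) (s' r N : ℕ) : Prop :=
  ∀ m₁ ≤ N, ∀ m₂ ≤ N, γ m₁ = γ m₂ → |(m₂ : ℤ) - (m₁ : ℤ)| ∉ Set.Icc (s' : ℤ) (r : ℤ)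

/-- `ℓ` is a `t`-local cut point of `γ`. -/
def IsLocalCutPoint {V : Type*} (γ : ℕ → V) (t ℓ : ℕ) : Prop :=
  t ≤ ℓ ∧ Disjoint (γ '' Set.Icc (ℓ - t) ℓ) (γ '' Set.Icc (ℓ + 1) (ℓ + t))

/-- Every window `[m, m + s]` with `0 ≤ m ≤ N - s` contains a `2s'`-local cut point. -/
def HasLocalCutPoints {V : Type*} (γ : ℕ → V) (s' s N : ℕ) : Prop :=
  ∀ m, m + s ≤ N → ∃ ℓ ∈ Set.Icc m (m + s), IsLocalCutPoint γ (2 * s') ℓ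

/-- The block `[(i - 1) r, i r - 1]`; it is empty for `i = 0`. -/
def block (r i : ℕ) : Set ℕ := {k | (i - 1) * r ≤ k ∧ k < i * r}

/-- The inner part `B_i = [(i - 1) r + 2 s, i r - s - 1]` of a block; it is empty for `i = 0`. -/
def innerBlock (r s i : ℕ) : Set ℕ := {k | (i - 1) * r + 2 * s ≤ k ∧ k + s < i * r}

/-- An inner block that meets a second one meets no further inner block. -/
def InnerBlocksMatched {V : Type*} (γ : ℕ → V) (r s N : ℕ) : Prop :=
  ∀ i ≤ N / r, ∀ j ≤ N / r, i ≠ j →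
    (γ '' innerBlock r s i ∩ γ '' innerBlock r s j).Nonempty →
    ∀ k₁ ≤ N / r, ∀ k₂ ≤ N / r, k₁ ∈ ({i, j} : Set ℕ) → k₂ ∉ ({i, j} : Set ℕ) →
      Disjoint (γ '' innerBlock r s k₁) (γ '' innerBlock r s k₂)

/-- For `j < i` the outer part of block `j` does not meet `[min B_i, max B_i + s]`, which is
`[(i - 1) r + 2 s, i r - 1]`. -/
def OuterMissesLaterBlocks {V : Type*} (γ : ℕ → V) (r s N : ℕ) : Prop :=
  ∀ i, 2 ≤ i → i ≤ N / r → ∀ j < i,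
    Disjoint (γ '' (block r j \ innerBlock r s j))
      (γ '' {k | (i - 1) * r + 2 * s ≤ k ∧ k < i * r})

/-- The outer part of block `i` does not meet `[0, max B_{i-1}] = [0, (i - 1) r - s - 1]`. -/
def OuterMissesPast {V : Type*} (γ : ℕ → V) (r s N : ℕ) : Prop :=
  ∀ i, 2 ≤ i → i ≤ N / r →
    Disjoint (γ '' {k | k + s < (i - 1) * r}) (γ '' (block r i \ innerBlock r s i))

/-- With `K = ⌊N / r⌋`: the path on `[r K + 2 s, N]` does not meet the path on `[0, r K - 1]`, and
the path on `[r K, r K + 2 s - 1]` does not meet the path on `[0, r K - s - 1]`. -/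
def FinalBlockMissesPast {V : Type*} (γ : ℕ → V) (r s N : ℕ) : Prop :=
  Disjoint (γ '' {k | k < r * (N / r)}) (γ '' {k | r * (N / r) + 2 * s ≤ k ∧ k ≤ N}) ∧
    Disjoint (γ '' {k | k + s < r * (N / r)})
      (γ '' {k | r * (N / r) ≤ k ∧ k < r * (N / r) + 2 * s})

/-! Along parent edges of the Aldous–Broder tree the time of the last visit strictly increases, up
to `n` at the root. The skeleton contains the root and is closed under parents
(`exists_notMem_ghostSet_of_succ`), so it is a subtree, isometrically embedded because paths in a
tree are unique. It remains to bound the distance to the skeleton by `r`.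

From a vertex last visited at time `k`, follow parents. A barrier `l` in `[k, k + s]`, a non-ghost
time crossed by no short loop (`exists_barrier`), gives within `s` steps either a skeleton vertex or
a vertex revisited more than `r` later. Such a jump joins two distinct inner blocks
(`exists_innerBlock_of_long_loop`). After one jump, repeat: a second jump would start in the block
where the first landed, so that block would meet two others, against (P.1). Hence the distance is at
most `2 * s ≤ r`. -/

/-! ### Graphs with a parent relation -/

/-- A graph whose edges join each vertex to its unique parent, along which `f` increases, has no
cycles. -/
theorem isAcyclic_of_parent {α : Type*} (H : SimpleGraph α) (P : α → α → Prop) (f : α → ℕ)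
    (hP : ∀ x y z, P x y → P x z → y = z) (hf : ∀ x y, P x y → f x < f y)
    (hadj : ∀ x y, H.Adj x y → P x y ∨ P y x) : H.IsAcyclic := by
  classical
  intro v c hc
  -- At a vertex of the cycle minimizing `f`, both cycle neighbours are its parent, hence equal.
  obtain ⟨u, hu, hmin⟩ := c.support.toFinset.exists_min_image f ⟨v, by simp⟩
  rw [List.mem_toFinset] at hu
  have hc' : (c.rotate u hu).IsCycle := hc.rotate hu
  have key : ∀ w ∈ (c.rotate u hu).support, H.Adj u w → P u w := by
    intro w hw h
    refine (hadj u w h).resolve_right fun h' => ?_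
    have h1 := hmin w (by simpa using hw)
    have h2 := hf w u h'
    omega
  refine hc'.snd_ne_penultimate (hP u _ _ (key _ ?_ ?_) (key _ ?_ ?_))
  · exact List.mem_of_mem_tail (SimpleGraph.Walk.snd_mem_tail_support hc'.not_nil)
  · exact SimpleGraph.Walk.adj_snd hc'.not_nil
  · exact (c.rotate u hu).getVert_mem_support _
  · exact (SimpleGraph.Walk.adj_penultimate hc'.not_nil).symm

theorem connected_of_parent {α : Type*} (H : SimpleGraph α) (ρ : α) (f : α → ℕ) (n : ℕ)
    (hn : ∀ x, f x ≤ n) (hf : ∀ x, x ≠ ρ → ∃ y, H.Adj x y ∧ f x < f y) : H.Connected := by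
  have key : ∀ d x, n - f x ≤ d → H.Reachable x ρ := by
    intro d
    induction d with
    | zero =>
      intro x hx
      by_cases h : x = ρ
      · exact h ▸ SimpleGraph.Reachable.refl _
      · obtain ⟨y, _, hlt⟩ := hf x h
        have := hn y
        omega
    | succ d ih =>
      intro x hx
      by_cases h : x = ρ
      · exact h ▸ SimpleGraph.Reachable.refl _
      · obtain ⟨y, hxy, hlt⟩ := hf x h
        exact hxy.reachable.trans (ih y (by omega))
  exact (SimpleGraph.connected_iff_exists_forall_reachable H).2
    ⟨ρ, fun x => (key _ x le_rfl).symm⟩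

/-! ### Isometric embeddings and Gromov–Hausdorff distance -/

/-- A connected graph that embeds into an acyclic one embeds isometrically. -/
theorem SimpleGraph.IsAcyclic.dist_map {α β : Type*} {H : SimpleGraph α} {H' : SimpleGraph β}
    (hH' : H'.IsAcyclic) (hH : H.Connected) (φ : H →g H') (hφ : Function.Injective φ) (x y : α) :
    H'.dist (φ x) (φ y) = H.dist x y := by
  obtain ⟨p, hp, hpl⟩ := hH.exists_path_of_dist x y
  have hp' : (p.map φ).IsPath := hp.map hφ
  obtain ⟨q, hq, hql⟩ := (p.map φ).reachable.exists_path_of_dist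
  have h := hH'.subsingleton_path _ _ |>.elim ⟨_, hp'⟩ ⟨q, hq⟩
  rw [← hql, ← hpl, ← congrArg (fun z : H'.Path _ _ => z.1.length) h, SimpleGraph.Walk.length_map]

/-- A space is within Gromov–Hausdorff distance `r` of an isometrically embedded space that comes
within distance `r` of each of its points. -/
theorem pointedGHDist_le_of_isometry {X Y : Type*} (mX : MetricSpace X) (x₀ : X)
    (mY : MetricSpace Y) (y₀ : Y) (φ : X → Y) (h₀ : φ x₀ = y₀)
    (hφ : ∀ x x', dist (φ x) (φ x') = dist x x') (r : ℕ)
    (hr : ∀ y, ∃ x, dist (φ x) y ≤ r) : pointedGHDist mX x₀ mY y₀ ≤ r := by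
  have hR : IsCorrespondence x₀ y₀ {p : X × Y | dist (φ p.1) p.2 ≤ r} := by
    refine ⟨by simp [h₀], fun x => ⟨φ x, by simp⟩, fun y => hr y⟩
  have hd : distortion mX mY {p : X × Y | dist (φ p.1) p.2 ≤ r} ≤ r * 2 := by
    refine iSup₂_le fun p hp => iSup₂_le fun q hq => ?_
    have h2 : (r * 2 : ℝ≥0∞) = ENNReal.ofReal (r * 2) := by
      rw [ENNReal.ofReal_mul (by positivity)]
      simp
    rw [h2]
    refine ENNReal.ofReal_le_ofReal ?_
    rw [← hφ]
    have h3 := abs_dist_sub_le (φ p.1) p.2 (φ q.1)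
    have h4 := abs_dist_sub_le (φ q.1) q.2 p.2
    rw [dist_comm (φ q.1) p.2, dist_comm q.2 p.2] at h4
    simp only [Set.mem_ofPred_eq] at hp hq
    rw [abs_le] at h3 h4 ⊢
    constructor <;> linarith
  calc pointedGHDist mX x₀ mY y₀ ≤ r * 2 / 2 :=
        ENNReal.div_le_div_right ((iInf₂_le _ hR).trans hd) 2
    _ = r := ENNReal.mul_div_cancel_right (by simp) (by simp)

/-! ### Last visits and ghost indices -/

section Path

variable {V : Type*} {γ : ℕ → V}

theorem exists_isLastVisit {n j : ℕ} (hj : j ≤ n) : ∃ k, IsLastVisit γ n (γ j) k := by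
  classical
  refine ⟨Nat.findGreatest (fun i => γ i = γ j) n, ⟨Nat.findGreatest_le n,
    Nat.findGreatest_spec (P := fun i => γ i = γ j) hj rfl⟩, fun i hi => ?_⟩
  exact Nat.le_findGreatest hi.1 hi.2

theorem IsLastVisit.unique {n k k' : ℕ} {x : V} (h : IsLastVisit γ n x k)
    (h' : IsLastVisit γ n x k') : k = k' :=
  IsGreatest.unique h h'

theorem IsABParent.unique {n : ℕ} {x y z : V} (h : IsABParent γ n x y) (h' : IsABParent γ n x z) :
    y = z := by
  obtain ⟨_, k, hk, rfl⟩ := h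
  obtain ⟨_, k', hk', rfl⟩ := h'
  rw [hk.unique hk']

theorem IsABParent.lastVisit_lt {n k l : ℕ} {x y : V} (h : IsABParent γ n x y)
    (hk : IsLastVisit γ n x k) (hl : IsLastVisit γ n y l) : k < l := by
  obtain ⟨hx, k', hk', rfl⟩ := h
  obtain rfl := hk.unique hk'
  have hkn : k ≠ n := fun h => hx (h ▸ hk.1.2.symm)
  have hle := hk.1.1
  have : k + 1 ≤ l := hl.2 ⟨by omega, rfl⟩
  omega

theorem ghostSet_mono (γ : ℕ → V) (s : ℕ) : Monotone (ghostSet γ s) :=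
  monotone_nat_of_le_succ fun _ => Set.subset_union_left

/-- An index that becomes a ghost index at time `n + 1` does so because the path closes a loop at
that time; the whole loop consists of ghost indices from then on. -/
theorem exists_loop_of_new_ghost {s n m : ℕ} (h : m ∈ ghostSet γ s (n + 1))
    (h' : m ∉ ghostSet γ s n) :
    ∃ m₁ ≤ m, n + 2 ≤ m₁ + s ∧ m₁ ∉ ghostSet γ s n ∧ γ m₁ = γ (n + 1) ∧
      ∀ k, m₁ ≤ k → k ≤ n → k ∈ ghostSet γ s (n + 1) ∧
        (k ∉ ghostSet γ s n → ∀ j < k, γ j = γ k → j ∈ ghostSet γ s n) := by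
  classical
  obtain ⟨hmn, _, ⟨h₀, hh₀, hγ₀⟩, hall⟩ := h.resolve_left h'
  set Q : ℕ → Prop := fun h => (n + 2 ≤ h + s ∧ h ∉ ghostSet γ s n) ∧ γ h = γ (n + 1) with hQ
  have hspec : Q (Nat.findGreatest Q m) :=
    Nat.findGreatest_spec hh₀.1.2 ⟨⟨hh₀.1.1, hh₀.2⟩, hγ₀⟩
  have hle : Nat.findGreatest Q m ≤ m := Nat.findGreatest_le m
  set m₁ := Nat.findGreatest Q m with hm₁
  have hfirst := hall m₁ ⟨⟨⟨⟨hspec.1.1, hle⟩, hspec.1.2⟩, hspec.2⟩,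
    fun i hi => Nat.le_findGreatest hi.1.1.2 ⟨⟨hi.1.1.1, hi.1.2⟩, hi.2⟩⟩
  refine ⟨m₁, hle, hspec.1.1, hspec.1.2, hspec.2, fun k hk hkn => ⟨?_, fun hkg j hj hjk => ?_⟩⟩
  · by_cases hkg : k ∈ ghostSet γ s n
    · exact Or.inl hkg
    · refine Or.inr ⟨hkn, hkg, ⟨m₁, ⟨⟨hspec.1.1, hk⟩, hspec.1.2⟩, hspec.2⟩, ?_⟩
      -- Raising the upper bound from `m` to `k` can only move the last visit later, so the
      -- first-visit condition is inherited.
      intro m₂ hm₂ i hi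
      have : m₁ ≤ m₂ := hm₂.2 ⟨⟨⟨hspec.1.1, hk⟩, hspec.1.2⟩, hspec.2⟩
      exact hfirst i ⟨⟨this.trans hi.1.1, hi.1.2⟩, hi.2⟩
  · by_contra hjg
    exact hfirst k ⟨⟨hk, by omega⟩, hkg⟩ ⟨j, ⟨hj, hjg⟩, hjk⟩

/-- Each ghost index lies on a loop of length less than `s`, and all earlier visits to the same
vertex are at ghost indices as well. -/
theorem exists_loop_of_mem_ghostSet {s n m : ℕ} (h : m ∈ ghostSet γ s n) :
    (∃ m₁ ≤ m, ∃ m₂ ≤ n, m < m₂ ∧ m₂ < m₁ + s ∧ γ m₁ = γ m₂) ∧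
      ∀ j < m, γ j = γ m → j ∈ ghostSet γ s n := by
  induction n with
  | zero => exact absurd h (Set.notMem_empty _)
  | succ n ih =>
    by_cases h' : m ∈ ghostSet γ s n
    · obtain ⟨⟨m₁, h1, m₂, h2, h3⟩, h4⟩ := ih h'
      exact ⟨⟨m₁, h1, m₂, by omega, h3⟩,
        fun j hj hjm => ghostSet_mono γ s (Nat.le_succ n) (h4 j hj hjm)⟩
    · obtain ⟨m₁, h1, h2, _, h3, h4⟩ := exists_loop_of_new_ghost h h'
      have hmn : m < n + 1 := ghostSet_lt γ s _ _ h
      exact ⟨⟨m₁, h1, n + 1, le_rfl, hmn, by omega, h3⟩, fun j hj hjm =>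
        ghostSet_mono γ s (Nat.le_succ n) ((h4 m h1 (by omega)).2 h' j hj hjm)⟩

/-- A vertex visited right after a non-ghost time is visited at a non-ghost time. -/
theorem exists_notMem_ghostSet_of_succ {s n k : ℕ} (hkn : k + 1 ≤ n) (hk : k ∉ ghostSet γ s n) :
    ∃ j, k < j ∧ j ≤ n ∧ j ∉ ghostSet γ s n ∧ γ j = γ (k + 1) ∧
      ∀ i, k < i → i < j → i ∈ ghostSet γ s n := by
  induction n with
  | zero => omega
  | succ n ih =>
    have hnot : n + 1 ∉ ghostSet γ s (n + 1) := fun h => lt_irrefl _ (ghostSet_lt γ s _ _ h)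
    rcases Nat.lt_or_eq_of_le hkn with hlt | heq
    · obtain ⟨j, hkj, hjn, hj, hγj, hall⟩ :=
        ih (by omega) fun h => hk (ghostSet_mono γ s (Nat.le_succ n) h)
      -- If `j` is erased at time `n + 1`, the erased loop starts after `k`, which survives, and at
      -- a non-ghost time up to `j`. All times between `k` and `j` were ghosts, so it starts at `j`,
      -- and `n + 1` revisits the same vertex. The clause on intermediate times serves this
      -- argument.
      by_cases hj' : j ∈ ghostSet γ s (n + 1)
      · obtain ⟨m₁, hm₁j, _, hm₁, hγm₁, hrun⟩ := exists_loop_of_new_ghost hj' hj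
        have h1 : k < m₁ := by
          by_contra h
          exact hk (hrun k (by omega) (by omega)).1
        have h2 : m₁ = j := by
          by_contra h
          exact hm₁ (hall m₁ h1 (by omega))
        subst h2
        refine ⟨n + 1, by omega, le_rfl, hnot, hγm₁ ▸ hγj, fun i hi hi' => ?_⟩
        rcases Nat.lt_or_ge i m₁ with h | h
        · exact ghostSet_mono γ s (Nat.le_succ n) (hall i hi h)
        · exact (hrun i h (by omega)).1
      · exact ⟨j, hkj, by omega, hj', hγj,
          fun i hi hi' => ghostSet_mono γ s (Nat.le_succ n) (hall i hi hi')⟩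
    · exact ⟨n + 1, by omega, le_rfl, hnot, by rw [heq], fun i _ _ => by omega⟩

/-! ### The skeleton as a subtree -/

variable {G : SimpleGraph V} (hγ : IsLazyPath G γ)

/-- A ghost index forces all earlier visits to its vertex to be ghosts, so the last visit decides.
-/
theorem mem_skel_verts_iff {s n k : ℕ} {x : V} (hk : IsLastVisit γ n x k) :
    x ∈ (skel hγ s n).verts ↔ k ∉ ghostSet γ s n := by
  constructor
  · rintro ⟨j, ⟨hj, hjg⟩, hjx⟩ hkg
    have hle : j ≤ k := hk.2 ⟨hj, hjx⟩
    rcases Nat.lt_or_eq_of_le hle with h | h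
    · exact hjg ((exists_loop_of_mem_ghostSet hkg).2 j h (hjx.trans hk.1.2.symm))
    · exact hjg (h ▸ hkg)
  · exact fun h => ⟨k, ⟨hk.1.1, h⟩, hk.1.2⟩

theorem exists_isLastVisit_of_mem {n : ℕ} {x : V} (hx : x ∈ (abTree hγ n).verts) :
    ∃ k, IsLastVisit γ n x k := by
  obtain ⟨j, hj, rfl⟩ := hx
  exact exists_isLastVisit hj

theorem skel_verts_subset (s n : ℕ) : (skel hγ s n).verts ⊆ (abTree hγ n).verts :=
  Set.image_mono Set.sdiff_subset

theorem IsLastVisit.isABParent {n k : ℕ} {x : V} (hk : IsLastVisit γ n x k) (hx : x ≠ γ n) :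
    k + 1 ≤ n ∧ IsABParent γ n x (γ (k + 1)) := by
  have hkn : k ≠ n := fun h => hx (h ▸ hk.1.2.symm)
  have hle := hk.1.1
  exact ⟨by omega, hx, k, hk, rfl⟩

theorem exists_isABParent_mem_skel {s n : ℕ} {x : V} (hx : x ∈ (skel hγ s n).verts)
    (hxn : x ≠ γ n) : ∃ y ∈ (skel hγ s n).verts, IsABParent γ n x y := by
  obtain ⟨k, hk⟩ := exists_isLastVisit_of_mem hγ (skel_verts_subset hγ s n hx)
  obtain ⟨hkn, hp⟩ := hk.isABParent hxn
  obtain ⟨j, _, hjn, hj, hγj, _⟩ :=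
    exists_notMem_ghostSet_of_succ hkn ((mem_skel_verts_iff hγ hk).1 hx)
  exact ⟨_, ⟨j, ⟨hjn, hj⟩, hγj⟩, hp⟩

/-- A subgraph of the Aldous–Broder tree is a tree if it contains the root and the edge from each
of its other vertices to the parent. -/
theorem isTree_coe_of_parent {n : ℕ} (T : G.Subgraph) (hT : T ≤ abTree hγ n)
    (hroot : γ n ∈ T.verts) (hpar : ∀ x ∈ T.verts, x ≠ γ n → ∃ y, T.Adj x y ∧ IsABParent γ n x y) :
    T.coe.IsTree := by
  choose f hf using fun x : T.verts => exists_isLastVisit_of_mem hγ (hT.1 x.2)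
  refine ⟨connected_of_parent _ ⟨γ n, hroot⟩ f n (fun x => (hf x).1.1) fun x hx => ?_,
    isAcyclic_of_parent _ (fun x y => IsABParent γ n x.1 y.1) f
      (fun x y z h h' => Subtype.ext (h.unique h')) (fun x y h => h.lastVisit_lt (hf x) (hf y))
      fun x y h => hT.2 h⟩
  obtain ⟨y, hxy, hp⟩ := hpar x.1 x.2 fun h => hx (Subtype.ext h)
  exact ⟨⟨y, hxy.snd_mem⟩, hxy, hp.lastVisit_lt (hf x) (hf ⟨y, hxy.snd_mem⟩)⟩

theorem abTree_isTree (n : ℕ) : (abTree hγ n).coe.IsTree := by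
  refine isTree_coe_of_parent hγ _ le_rfl (root_mem_abTree hγ n) fun x hx hxn => ?_
  obtain ⟨k, hk⟩ := exists_isLastVisit_of_mem hγ hx
  exact ⟨_, Or.inl (hk.isABParent hxn).2, (hk.isABParent hxn).2⟩

theorem skel_le_abTree (s n : ℕ) : skel hγ s n ≤ abTree hγ n :=
  ⟨skel_verts_subset hγ s n, fun _ _ h => h.2.2⟩

theorem skel_isTree (s n : ℕ) : (skel hγ s n).coe.IsTree := by
  refine isTree_coe_of_parent hγ _ (skel_le_abTree hγ s n) (root_mem_skel hγ s n)
    fun x hx hxn => ?_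
  obtain ⟨y, hy, hp⟩ := exists_isABParent_mem_skel hγ hx hxn
  exact ⟨y, ⟨hx, hy, Or.inl hp⟩, hp⟩

/-! ### Distance to the skeleton -/

/-- Every window of length `s` in `[0, n]` contains a non-ghost time that is not crossed by any loop
of length at most `r`. -/
theorem exists_barrier {r s s' N n : ℕ} (hs : s ≤ r) (hs' : 1 ≤ s') (hn : n ≤ N)
    (hloops : NoIntermediateLoops γ s' r N) (hcut : HasLocalCutPoints γ s' s N) {k : ℕ}
    (hk : k ≤ n) :
    ∃ l, k ≤ l ∧ l ≤ k + s ∧ l ≤ n ∧ l ∉ ghostSet γ s n ∧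
      ∀ a b, a ≤ l → l < b → b ≤ n → γ a = γ b → a + r < b := by
  by_cases h : ∃ l, k ≤ l ∧ l ≤ k + s ∧ l ≤ n ∧ IsLocalCutPoint γ (2 * s') l
  · obtain ⟨l, hkl, hls, hln, hl, hdisj⟩ := h
    -- A loop across `l` of length at most `r` has length below `s'`, so both ends fall in the two
    -- windows that the cut point separates.
    have key : ∀ a b, a ≤ l → l < b → b ≤ n → γ a = γ b → a + r < b := by
      intro a b ha hb hbn hab
      have h1 := hloops a (by omega) b (by omega) hab
      rw [abs_of_nonneg (by omega), Set.mem_Icc] at h1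
      by_contra hlt
      have h2 : b < a + s' := by omega
      exact Set.disjoint_left.1 hdisj ⟨a, ⟨by omega, ha⟩, rfl⟩ ⟨b, ⟨by omega, by omega⟩, hab.symm⟩
    refine ⟨l, hkl, hls, hln, fun hg => ?_, key⟩
    obtain ⟨⟨m₁, h1, m₂, h2, h3, h4, h5⟩, _⟩ := exists_loop_of_mem_ghostSet hg
    have := key m₁ m₂ h1 h3 h2 h5
    omega
  -- With no cut point available, `n ≤ k + s`, and `n` itself is a barrier: never a ghost, with no
  -- later time to cross to.
  · refine ⟨n, hk, ?_, le_rfl, fun h => lt_irrefl n (ghostSet_lt γ s n n h),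
      fun a b _ h1 h2 => by omega⟩
    by_contra hlt
    obtain ⟨l, hl, hl'⟩ := hcut k (by omega)
    have := hl.2
    exact h ⟨l, hl.1, hl.2, by omega, hl'⟩

/-- Following parents from `x`, within the time up to a barrier `l` one meets the skeleton or a
vertex that is visited again after a long time. -/
theorem exists_near_skel_or_jump {r s n l : ℕ} (hln : l ≤ n) (hl : l ∉ ghostSet γ s n)
    (hcross : ∀ a b, a ≤ l → l < b → b ≤ n → γ a = γ b → a + r < b) :
    ∀ d k (x : (abTree hγ n).verts), IsLastVisit γ n x.1 k → k ≤ l → l ≤ k + d →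
      ∃ z : (abTree hγ n).verts, (abTree hγ n).coe.dist z x ≤ d ∧
        (z.1 ∈ (skel hγ s n).verts ∨
          ∃ a b, k < a ∧ a ≤ l ∧ a + r < b ∧ γ a = γ b ∧ IsLastVisit γ n z.1 b) := by
  intro d
  induction d with
  | zero =>
    intro k x hk hkl hld
    obtain rfl : k = l := by omega
    exact ⟨x, by simp, Or.inl ((mem_skel_verts_iff hγ hk).2 hl)⟩
  | succ d ih =>
    intro k x hk hkl hld
    by_cases hx : x.1 ∈ (skel hγ s n).verts
    · exact ⟨x, by simp, Or.inl hx⟩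
    have hxn : x.1 ≠ γ n := fun h => hx (h ▸ root_mem_skel hγ s n)
    have hkl' : k < l := by
      refine lt_of_le_of_ne hkl fun h => hx ((mem_skel_verts_iff hγ hk).2 (h ▸ hl))
    obtain ⟨hkn, hp⟩ := hk.isABParent hxn
    obtain ⟨b, hb⟩ := exists_isLastVisit (γ := γ) hkn
    have hkb := hp.lastVisit_lt hk hb
    set y : (abTree hγ n).verts := ⟨γ (k + 1), k + 1, hkn, rfl⟩ with hy
    have hyx : (abTree hγ n).coe.Adj y x := Or.inr hp
    -- Either the last visit to the parent lies beyond the barrier, which is a jump from `k + 1`, or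
    -- it is still in `(k, l]` and the remaining time has dropped.
    rcases Nat.lt_or_ge l b with h | h
    · have hj := hcross (k + 1) b hkl' h hb.1.1 hb.1.2.symm
      refine ⟨y, ?_, Or.inr ⟨k + 1, b, by omega, hkl', hj, hb.1.2.symm, hb⟩⟩
      rw [SimpleGraph.dist_eq_one_iff_adj.2 hyx]
      omega
    · obtain ⟨z, hz, hz'⟩ := ih b y hb h (by omega)
      refine ⟨z, ?_, ?_⟩
      · have h1 := (abTree_isTree hγ n).connected.dist_triangle (u := z) (v := y) (w := x)
        rw [SimpleGraph.dist_eq_one_iff_adj.2 hyx] at h1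
        omega
      · exact hz'.imp_right fun ⟨a, b', h1, h2⟩ => ⟨a, b', by omega, h2⟩

/-! ### Long loops and blocks -/

/-- A long loop joins two different inner blocks. -/
theorem exists_innerBlock_of_long_loop {r s N : ℕ} (hr : 3 * s + 1 ≤ r)
    (hP2 : OuterMissesLaterBlocks γ r s N) (hP3 : OuterMissesPast γ r s N)
    (hP4 : FinalBlockMissesPast γ r s N) {a b : ℕ} (hab : a + r < b) (hb : b ≤ N)
    (h : γ a = γ b) :
    ∃ i j, i < j ∧ j ≤ N / r ∧ a ∈ innerBlock r s i ∧ b ∈ innerBlock r s j := by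
  have hr0 : 0 < r := by omega
  have hNr := Nat.div_add_mod N r
  have hNr' := Nat.mod_lt N hr0
  have ha1 := Nat.div_add_mod a r
  have ha2 := Nat.mod_lt a hr0
  have hb1 := Nat.div_add_mod b r
  have hb2 := Nat.mod_lt b hr0
  obtain ⟨hF1, hF2⟩ := hP4
  -- (P.4) keeps `b` out of the incomplete last block: `a + r < b` and `3 * s + 1 ≤ r` put `a` far
  -- enough in the past in both cases.
  have hbK : b < r * (N / r) := by
    by_contra hge
    rcases Nat.lt_or_ge b (r * (N / r) + 2 * s) with h1 | h1
    · exact Set.disjoint_left.1 hF2 ⟨a, show a + s < _ by omega, h⟩ ⟨b, ⟨by omega, h1⟩, rfl⟩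
    · exact Set.disjoint_left.1 hF1 ⟨a, show a < _ by omega, h⟩ ⟨b, ⟨h1, hb⟩, rfl⟩
  have hdiv : a / r < b / r := by
    have : (a + r) / r ≤ b / r := Nat.div_le_div_right hab.le
    rw [Nat.add_div_right _ hr0] at this
    omega
  have hb0 : 0 < b / r := (Nat.zero_le _).trans_lt hdiv
  have hbK' : b / r < N / r := Nat.div_lt_of_lt_mul hbK
  have hab_mem : a ∈ block r (a / r + 1) := by
    refine ⟨?_, ?_⟩
    · rw [Nat.add_sub_cancel, mul_comm]; omega
    · rw [add_mul, mul_comm]; omega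
  have hbb_mem : b ∈ block r (b / r + 1) := by
    refine ⟨?_, ?_⟩
    · rw [Nat.add_sub_cancel, mul_comm]; omega
    · rw [add_mul, mul_comm]; omega
  have hmono : r * (a / r) + r ≤ r * (b / r) := by
    rw [← Nat.mul_succ]; exact Nat.mul_le_mul_left r hdiv
  have hbB : b ∈ innerBlock r s (b / r + 1) := by
    by_contra hbB
    -- For `b` in an outer part, (P.3) excludes all `a` up to the end of the previous inner block.
    -- Otherwise `a` is in the outer part at the end of that block, and `a + r < b` puts `b` in the
    -- last `s` times of its own block, where (P.2) applies.
    by_cases hpast : a + s < (b / r + 1 - 1) * r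
    · exact Set.disjoint_left.1 (hP3 (b / r + 1) (by omega) (by omega)) ⟨a, hpast, h⟩
        ⟨b, ⟨hbb_mem, hbB⟩, rfl⟩
    · rw [Nat.add_sub_cancel, mul_comm] at hpast
      refine Set.disjoint_left.1 (hP2 (b / r + 1) (by omega) (by omega) (a / r + 1) (by omega))
        ⟨a, ⟨hab_mem, fun haB => ?_⟩, h⟩ ⟨b, ⟨?_, hbb_mem.2⟩, rfl⟩
      · have := haB.2
        rw [add_mul, mul_comm] at this
        omega
      · rw [Nat.add_sub_cancel, mul_comm]; omega
  refine ⟨a / r + 1, b / r + 1, by omega, by omega, ?_, hbB⟩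
  by_contra haB
  exact Set.disjoint_left.1 (hP2 (b / r + 1) (by omega) (by omega) (a / r + 1) (by omega))
    ⟨a, ⟨hab_mem, haB⟩, h⟩ ⟨b, ⟨hbB.1, hbb_mem.2⟩, rfl⟩

/-- The gap between successive inner blocks is longer than `s`. -/
theorem innerBlock_index_eq {r s i j a b : ℕ} (ha : a ∈ innerBlock r s i)
    (hb : b ∈ innerBlock r s j) (hab : a < b) (hba : b ≤ a + s) : i = j := by
  obtain ⟨h1, h2⟩ := ha
  obtain ⟨h3, h4⟩ := hb
  rcases lt_trichotomy i j with h | h | h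
  · have : i * r ≤ (j - 1) * r := Nat.mul_le_mul_right r (by omega)
    omega
  · exact h
  · have : j * r ≤ (i - 1) * r := Nat.mul_le_mul_right r (by omega)
    omega

theorem exists_skel_vertex_near {r s s' N : ℕ} (hs' : 1 ≤ s') (hr : 3 * s + 1 ≤ r)
    (hloops : NoIntermediateLoops γ s' r N) (hcut : HasLocalCutPoints γ s' s N)
    (hP1 : InnerBlocksMatched γ r s N) (hP2 : OuterMissesLaterBlocks γ r s N)
    (hP3 : OuterMissesPast γ r s N) (hP4 : FinalBlockMissesPast γ r s N) {n : ℕ} (hn : n ≤ N)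
    (x : (abTree hγ n).verts) :
    ∃ z : (abTree hγ n).verts, z.1 ∈ (skel hγ s n).verts ∧ (abTree hγ n).coe.dist z x ≤ 2 * s := by
  have hsr : s ≤ r := by omega
  obtain ⟨k, hk⟩ := exists_isLastVisit_of_mem hγ x.2
  obtain ⟨l, hkl, hls, hln, hl, hcross⟩ := exists_barrier hsr hs' hn hloops hcut hk.1.1
  obtain ⟨z, hz, hz' | ⟨a, b, hka, hal, hab, hγab, hb⟩⟩ :=
    exists_near_skel_or_jump hγ hln hl hcross s k x hk hkl hls
  · exact ⟨z, hz', by omega⟩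
  obtain ⟨l', hbl, hls', hln', hl', hcross'⟩ := exists_barrier hsr hs' hn hloops hcut hb.1.1
  obtain ⟨w, hw, hw' | ⟨a', b', hka', hal', hab', hγab', hb'⟩⟩ :=
    exists_near_skel_or_jump hγ hln' hl' hcross' s b z hb hbl hls'
  · have := (abTree_isTree hγ n).connected.dist_triangle (u := w) (v := z) (w := x)
    exact ⟨w, hw', by omega⟩
  · exfalso
    obtain ⟨i, j, hij, hj, hai, hbj⟩ :=
      exists_innerBlock_of_long_loop hr hP2 hP3 hP4 hab (hb.1.1.trans hn) hγab
    obtain ⟨i', j', hij', hj', hai', hbj'⟩ :=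
      exists_innerBlock_of_long_loop hr hP2 hP3 hP4 hab' (hb'.1.1.trans hn) hγab'
    -- The second jump leaves at `a'` with `b < a' ≤ b + s`, hence from the inner block of `b`.
    obtain rfl := innerBlock_index_eq hbj hai' hka' (by omega)
    refine Set.disjoint_left.1 (hP1 i (by omega) j hj hij.ne ⟨γ a, ⟨a, hai, rfl⟩, b, hbj, hγab.symm⟩
      j hj j' hj' (by simp) ?_) ⟨a', hai', rfl⟩ ⟨b', hbj', hγab'.symm⟩
    simp only [Set.mem_insert_iff, Set.mem_singleton_iff]
    omega

end Path

theorem mainTheorem3 {V : Type*} [Finite V] (G : SimpleGraph V) (hG : G.Connected)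
    (r s s' N : ℕ) (hs' : 1 ≤ s') (hs : 18 * s' + 1 ≤ 3 * s + 1) (hr : 3 * s + 1 ≤ r)
    (γ : ℕ → V) (hγ : IsLazyPath G γ)
    (hloops : NoIntermediateLoops γ s' r N) (hcut : HasLocalCutPoints γ s' s N)
    (hP1 : InnerBlocksMatched γ r s N) (hP2 : OuterMissesLaterBlocks γ r s N)
    (hP3 : OuterMissesPast γ r s N) (hP4 : FinalBlockMissesPast γ r s N) :
    ∀ n ≤ N, ∃ (hS : (skel hγ s n).coe.IsTree) (hA : (abTree hγ n).coe.IsTree),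
      pointedGHDist
        (graphMetric (skel hγ s n).coe hS.connected) ⟨γ n, root_mem_skel hγ s n⟩
        (graphMetric (abTree hγ n).coe hA.connected) ⟨γ n, root_mem_abTree hγ n⟩ ≤ (r : ℝ≥0∞) := by
  intro n hn
  refine ⟨skel_isTree hγ s n, abTree_isTree hγ n, ?_⟩
  refine pointedGHDist_le_of_isometry _ _ _ _
    (SimpleGraph.Subgraph.inclusion (skel_le_abTree hγ s n)) rfl (fun x y => ?_) r fun y => ?_
  · exact congrArg (Nat.cast : ℕ → ℝ) ((abTree_isTree hγ n).isAcyclic.dist_map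
      (skel_isTree hγ s n).connected _ (SimpleGraph.Subgraph.inclusion.injective _) x y)
  · obtain ⟨z, hz, hd⟩ := exists_skel_vertex_near hγ hs' hr hloops hcut hP1 hP2 hP3 hP4 hn y
    refine ⟨⟨z.1, hz⟩, ?_⟩
    have hd' : (abTree hγ n).coe.dist z y ≤ r := by omega
    exact Nat.cast_le (α := ℝ).2 hd'
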